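/- **Setting.** Let $A\in\mathbb R^{n\times n}$ be symmetric positive definite. Let $\Omega^1,\dots,\Omega^N\subset\{1,\dots,n\}$ with $\bigcup_s\Omega^s=\{1,\dots,n\}$, let $n^s=\#\Omega^s$, and let $R^s\in\mathbb R^{n^s\times n}$ be the restriction matrix to $\Omega^s$ (the identity on the columns in $\Omega^s$, zero elsewhere). Let $D^s\in\mathbb R^{n^s\times n^s}$ be symmetric nonsingular matrices with $\sum_{s=1}^N (R^s)^\top D^sR^s=I$ (for instance $D^s=R^s\big(\sum_t (R^t)^\top R^t\big)^{-1}(R^s)^\top$). Let $B^s\in\mathbb R^{n^s\times n^s}$ be symmetric matrices with $A=\sum_{s=1}^N (R^s)^\top B^sR^s$. Write $B^s=V^s\Lambda^s(V^s)^\top$ with $V^s$ orthogonal and $\Lambda^s$ diagonal, let $\Lambda^s_+$ be the block of positive diagonal entries of $\Lambda^s$ and $V^s_+$ the corresponding columns of $V^s$, and set $$A_+^s=V_+^s\Lambda_+^s(V_+^s)^\top,\qquad A_+=\sum_{s=1}^N (R^s)^\top A_+^sR^s .$$ For $M_A\in\mathbb R^{m\times m}$ symmetric positive semi-definite, $M_B\in\mathbb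 R^{m\times m}$ symmetric positive definite and $\tau>0$, let $y_1,\dots,y_m$ be linearly independent vectors with $\langle y_k,M_By_k\rangle=1$ and $M_Ay_k=\lambda_kM_By_k$, where $\lambda_1\le\dots\le\lambda_m$. Let $m_L$ be the least $k\in\{0,\dots,m-1\}$ with $\lambda_{k+1}\ge\tau$, and $m_L=m$ if there is none. Put $Y_L(\tau,M_A,M_B)=[y_1|\dots|y_{m_L}]$. The coloring constant $\mathcal N(A_+)\in\mathbb N$ is any number such that $\{1,\dots,N\}$ is the union of pairwise disjoint sets $\mathcal C_1,\dots,\mathcal C_{\mathcal N(A_+)}$ for which $s,t\in\mathcal C_j$, $s\ne t$ implies $R^sA_+(R^t)^\top=0$. **Theorem.** Let $\tau_\flat>1$ and $0<\tau_\sharp<1$, let $$V^0=\sum_{s=1}^N\operatorname{range}\Big((R^s)^\top Y_L\big(\tau_\flat^{-1},(D^s)^{-1}A_+^s(D^s)^{-1},R^sA(R^s)^\top\big)\Big)+\sum_{s=1}^N\operatorname{range}\Big((R^s)^\top Y_L\big(\tau_\sharp,R^sA(R^s)^\top,R^sA_+(R^s)^\top\big)\Big),$$ and let $R^0\in\mathbb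 R^{n^0\times n}$, with $n^0=\dim V^0$, be a matrix whose rows form a basis of $V^0$. Set $$H^{\mathrm{AS}}=\sum_{s=1}^N (R^s)^\top\big(R^sA(R^s)^\top\big)^{-1}R^s,\qquad \Pi=I-(R^0)^\top\big(R^0A_+(R^0)^\top\big)^{-1}R^0A_+,$$ $$H^{\mathrm{AS}}_{\mathrm{hyb}}=\Pi H^{\mathrm{AS}}\Pi^\top+(R^0)^\top\big(R^0A_+(R^0)^\top\big)^{-1}R^0 .$$ Then every (a priori complex) eigenvalue $\lambda$ of $H^{\mathrm{AS}}_{\mathrm{hyb}}A_+$ is real and satisfies $$\frac1{\tau_\flat}\le\lambda\le\frac{\mathcal N(A_+)}{\tau_\sharp}.$$ -/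

import Mathlib

open scoped Matrix

namespace AWG

noncomputable section

variable {n N : ℕ}

/-- The restriction matrix `R^s : ℝ^n → ℝ^{n^s}` of a set `S = Ω^s` of indices: the identity on the
columns in `S`, zero elsewhere.  Its rows are indexed by the elements of `S`, so `n^s = #S`. -/
def restriction (S : Finset (Fin n)) : Matrix S (Fin n) ℝ :=
  Matrix.of fun i j => if (i : Fin n) = j then 1 else 0

/-- A partition of unity: symmetric nonsingular local matrices `D^s` with `∑ R^sᵀ D^s R^s = 1`.
Nonsingularity gives a meaning to `D^s⁻¹`, symmetry makes `D^s⁻¹ A₊^s D^s⁻¹` symmetric. -/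
structure IsPartitionOfUnity (Ω : Fin N → Finset (Fin n)) (D : ∀ s, Matrix (Ω s) (Ω s) ℝ) :
    Prop where
  isSymm : ∀ s, (D s).IsSymm
  nonsingular : ∀ s, IsUnit (D s).det
  sum_eq_one : ∑ s, (restriction (Ω s))ᵀ * D s * restriction (Ω s) = 1

/-- The standard partition of unity `D^s = R^s (∑ₜ R^tᵀ R^t)⁻¹ R^sᵀ`, whose diagonal entries are the
inverses of the multiplicities of the indices. -/
def multiplicityPOU (Ω : Fin N → Finset (Fin n)) (s : Fin N) : Matrix (Ω s) (Ω s) ℝ :=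
  restriction (Ω s) * (∑ t, (restriction (Ω t))ᵀ * restriction (Ω t))⁻¹ * (restriction (Ω s))ᵀ

/-- `k` is an admissible value of the coloring constant `𝒩(M)`: the subdomains are split into `k`
pairwise disjoint classes, and two distinct subdomains `s, t` of one class satisfy
`R^s M R^tᵀ = 0`. -/
def IsColoringConstant (Ω : Fin N → Finset (Fin n)) (M : Matrix (Fin n) (Fin n) ℝ) (k : ℕ) :
    Prop :=
  ∃ C : Fin k → Set (Fin N),
    (∀ i j, i ≠ j → Disjoint (C i) (C j)) ∧
    (⋃ j, C j) = Set.univ ∧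
    ∀ j, ∀ s ∈ C j, ∀ t ∈ C j,
      restriction (Ω s) * M * (restriction (Ω t))ᵀ = 0 ∨ s = t

/-- `B = V Λ Vᵀ` is an orthogonal diagonalization, with `Λ = diag d`. -/
structure IsDiagonalization {ι : Type*} [Fintype ι] [DecidableEq ι]
    (B V : Matrix ι ι ℝ) (d : ι → ℝ) : Prop where
  orthogonal : V ∈ Matrix.orthogonalGroup ι ℝ
  eq : B = V * Matrix.diagonal d * Vᵀ

/-- The positive part `V₊ Λ₊ V₊ᵀ` of `V (diag d) Vᵀ`: only the columns of `V` that belong to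
positive eigenvalues are kept. -/
def positivePart {ι : Type*} [Fintype ι] [DecidableEq ι] (V : Matrix ι ι ℝ) (d : ι → ℝ) :
    Matrix ι ι ℝ :=
  let Vp : Matrix ι {k : ι // 0 < d k} ℝ := V.submatrix id Subtype.val
  Vp * Matrix.diagonal (fun k : {k : ι // 0 < d k} => d k) * Vpᵀ

/-- The assembled matrix `∑ₛ R^sᵀ L^s R^s` of local matrices `L^s`. -/
def assemble (Ω : Fin N → Finset (Fin n)) (L : ∀ s, Matrix (Ω s) (Ω s) ℝ) :
    Matrix (Fin n) (Fin n) ℝ :=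
  ∑ s, (restriction (Ω s))ᵀ * L s * restriction (Ω s)

/-- `(lam k, y k)` is a complete system of eigenpairs of the pencil `(MA, MB)`, ordered by the
eigenvalue and `MB`-normalized.  Completeness is linear independence of `m` vectors in `ℝ^m`. -/
structure IsEigenpairs {ι : Type*} [Fintype ι] (MA MB : Matrix ι ι ℝ)
    (lam : Fin (Fintype.card ι) → ℝ) (y : Fin (Fintype.card ι) → ι → ℝ) : Prop where
  ordered : Monotone lam
  linearIndependent : LinearIndependent ℝ y
  normalized : ∀ k, y k ⬝ᵥ (MB *ᵥ y k) = 1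
  eigen : ∀ k, MA *ᵥ y k = lam k • (MB *ᵥ y k)

/-- The number `m_L` of eigenvalues below the threshold: with indices starting at `0`, the least
`k` with `τ ≤ lam k`, and `m` if there is none. -/
def lowCount {m : ℕ} (τ : ℝ) (lam : Fin m → ℝ) : ℕ :=
  sInf ({k : ℕ | ∃ h : k < m, τ ≤ lam ⟨k, h⟩} ∪ {m})

theorem lowCount_le {m : ℕ} (τ : ℝ) (lam : Fin m → ℝ) : lowCount τ lam ≤ m :=
  Nat.sInf_le (Or.inr rfl)

/-- `Y_L(τ, M_A, M_B)`: the matrix whose columns are the first `m_L` eigenvectors. -/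
def lowEigenvectors {ι : Type*} {m : ℕ} (τ : ℝ) (lam : Fin m → ℝ) (y : Fin m → ι → ℝ) :
    Matrix ι (Fin (lowCount τ lam)) ℝ :=
  Matrix.of fun i k => y (Fin.castLE (lowCount_le τ lam) k) i

/-- The range (column space) of a matrix. -/
def matRange {ι κ : Type*} [Fintype κ] (M : Matrix ι κ ℝ) : Submodule ℝ (ι → ℝ) :=
  LinearMap.range M.mulVecLin

/-- `∑ₛ range (R^sᵀ Y_L^s)`, where `Y_L^s` holds the eigenvectors of the `s`-th pencil below the
threshold `τ`. -/
def lowSpace (Ω : Fin N → Finset (Fin n)) (τ : ℝ)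
    (lam : ∀ s, Fin (Fintype.card (Ω s)) → ℝ)
    (y : ∀ s, Fin (Fintype.card (Ω s)) → Ω s → ℝ) : Submodule ℝ (Fin n → ℝ) :=
  ⨆ s, matRange ((restriction (Ω s))ᵀ * lowEigenvectors τ (lam s) (y s))

/-- The lines of `R0` are a basis of the coarse space `V0`. -/
structure IsInterpolation {n0 : ℕ} (V0 : Submodule ℝ (Fin n → ℝ))
    (R0 : Matrix (Fin n0) (Fin n) ℝ) : Prop where
  range_eq : matRange R0ᵀ = V0
  dim_eq : n0 = Module.finrank ℝ V0

/-- The one-level additive Schwarz preconditioner `H^AS = ∑ₛ R^sᵀ (R^s A R^sᵀ)⁻¹ R^s`. -/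
def oneLevelAS (Ω : Fin N → Finset (Fin n)) (A : Matrix (Fin n) (Fin n) ℝ) :
    Matrix (Fin n) (Fin n) ℝ :=
  ∑ s, (restriction (Ω s))ᵀ * (restriction (Ω s) * A * (restriction (Ω s))ᵀ)⁻¹ * restriction (Ω s)

/-- The exact coarse solver `R0ᵀ (R0 M R0ᵀ)⁻¹ R0`. -/
def coarseSolve {n0 : ℕ} (M : Matrix (Fin n) (Fin n) ℝ) (R0 : Matrix (Fin n0) (Fin n) ℝ) :
    Matrix (Fin n) (Fin n) ℝ :=
  R0ᵀ * (R0 * M * R0ᵀ)⁻¹ * R0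

/-- The coarse projector `Π = 1 - R0ᵀ (R0 M R0ᵀ)⁻¹ R0 M`. -/
def coarseProjector {n0 : ℕ} (M : Matrix (Fin n) (Fin n) ℝ) (R0 : Matrix (Fin n0) (Fin n) ℝ) :
    Matrix (Fin n) (Fin n) ℝ :=
  1 - coarseSolve M R0 * M

/-- The hybrid two-level preconditioner `Π H Πᵀ + R0ᵀ (R0 M R0ᵀ)⁻¹ R0` for the matrix `M`, built on
the one-level preconditioner `H`. -/
def hybrid {n0 : ℕ} (H M : Matrix (Fin n) (Fin n) ℝ) (R0 : Matrix (Fin n0) (Fin n) ℝ) :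
    Matrix (Fin n) (Fin n) ℝ :=
  coarseProjector M R0 * H * (coarseProjector M R0)ᵀ + coarseSolve M R0

theorem restriction_transpose_mul (S : Finset (Fin n)) :
    (restriction S)ᵀ * restriction S = Matrix.diagonal fun i => if i ∈ S then (1 : ℝ) else 0 := by
  ext i j
  simp only [Matrix.mul_apply, Matrix.transpose_apply, restriction, Matrix.of_apply,
    Matrix.diagonal_apply]
  rw [Finset.sum_coe_sort S (fun k => (if k = i then (1 : ℝ) else 0) * (if k = j then 1 else 0))]
  by_cases h : i = j
  · subst h; simp
  · simp only [h, if_false]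
    refine Finset.sum_eq_zero fun k _ => ?_
    by_cases hk : k = i
    · subst hk; simp [h]
    · simp [hk]

theorem restriction_mul_diagonal (S : Finset (Fin n)) (v : Fin n → ℝ) :
    restriction S * Matrix.diagonal v * (restriction S)ᵀ =
      Matrix.diagonal fun i : S => v i := by
  ext i j
  rw [Matrix.mul_apply, Finset.sum_eq_single (i : Fin n)]
  · by_cases h : i = j
    · subst h; simp [Matrix.mul_diagonal, restriction]
    · have h2 : ¬ ((j : Fin n) = i) := fun e => h (Subtype.ext e.symm)
      simp [Matrix.mul_diagonal, restriction, h, h2]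
  · intro b _ hb
    simp [Matrix.mul_diagonal, restriction, Ne.symm hb]
  · simp

/-- If the sets `Ω^s` cover all indices, the standard choice is a partition of unity. -/
theorem isPartitionOfUnity_multiplicityPOU (Ω : Fin N → Finset (Fin n))
    (hΩ : ∀ i, ∃ s, i ∈ Ω s) : IsPartitionOfUnity Ω (multiplicityPOU Ω) := by
  set c : Fin n → ℝ := fun i => ∑ t, if i ∈ Ω t then (1 : ℝ) else 0 with hc
  have hpos : ∀ i, 0 < c i := by
    intro i
    obtain ⟨s, hs⟩ := hΩ i
    refine Finset.sum_pos' (fun t _ => ?_) ⟨s, Finset.mem_univ _, ?_⟩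
    · split_ifs <;> norm_num
    · simp [hs]
  have hsum : ∑ t, (restriction (Ω t))ᵀ * restriction (Ω t) = Matrix.diagonal c := by
    simp only [restriction_transpose_mul]
    ext i j
    rw [Matrix.sum_apply]
    by_cases h : i = j
    · subst h; simp [hc]
    · simp [h]
  have hinv : (Matrix.diagonal c)⁻¹ = Matrix.diagonal fun i => (c i)⁻¹ := by
    refine Matrix.inv_eq_right_inv ?_
    rw [Matrix.diagonal_mul_diagonal, ← Matrix.diagonal_one]
    congr 1
    funext i
    exact mul_inv_cancel₀ (hpos i).ne'
  have hD : ∀ s, multiplicityPOU Ω s = Matrix.diagonal fun i : Ω s => (c i)⁻¹ := by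
    intro s
    rw [multiplicityPOU, hsum, hinv, restriction_mul_diagonal]
  refine ⟨fun s => ?_, fun s => ?_, ?_⟩
  · rw [hD]; exact Matrix.isSymm_diagonal _
  · rw [hD, Matrix.det_diagonal, isUnit_iff_ne_zero]
    exact Finset.prod_ne_zero_iff.2 fun i _ => inv_ne_zero (hpos i).ne'
  · have h : ∀ s, (restriction (Ω s))ᵀ * multiplicityPOU Ω s * restriction (Ω s) =
        Matrix.diagonal (fun i => if i ∈ Ω s then (1 : ℝ) else 0) *
          Matrix.diagonal fun i => (c i)⁻¹ := by
      intro s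
      have e : (restriction (Ω s))ᵀ * multiplicityPOU Ω s * restriction (Ω s) =
          ((restriction (Ω s))ᵀ * restriction (Ω s)) * (Matrix.diagonal fun i => (c i)⁻¹) *
            ((restriction (Ω s))ᵀ * restriction (Ω s)) := by
        rw [multiplicityPOU, hsum, hinv]
        simp only [Matrix.mul_assoc]
      rw [e, restriction_transpose_mul]
      simp only [Matrix.diagonal_mul_diagonal]
      congr 1
      funext i
      split_ifs <;> simp
    simp only [h]
    rw [← Finset.sum_mul]
    have h2 : ∑ s, Matrix.diagonal (fun i => if i ∈ Ω s then (1 : ℝ) else 0) =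
        Matrix.diagonal c := by
      rw [← hsum]
      simp only [restriction_transpose_mul]
    rw [h2, Matrix.diagonal_mul_diagonal, ← Matrix.diagonal_one]
    congr 1
    funext i
    exact mul_inv_cancel₀ (hpos i).ne'

end

end AWG

/-! Write `⟨·,·⟩` for the Euclidean product, `A_s = R^s A R^sᵀ`, `H = H^AS`. Since `A₊ - A` is an
assembled sum of positive semidefinite matrices, `A₊` is positive definite, so `H_hyb A₊` has real
eigenvalues with real eigenvectors `x`. As `R⁰ A₊ Π = 0`, either the eigenvalue is `1`, or `x` is
`A₊`-orthogonal to `V⁰` and `⟨H A₊x, A₊x⟩ = λ ⟨x, A₊x⟩`. It remains to bound `H` on that complement.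

Both bounds rest on `⟨H w, w⟩ = ∑ ⟨p_s, A_s p_s⟩`, where `A_s p_s = R^s w` and `w = A₊x`. Lower
(`oneLevelAS_lower_bound`): removing from `D^s R^s x` its low part in the first pencil leaves all
pairings with `A₊x` unchanged and gives a splitting of `A`-energy at most `τ♭ ⟨x, A₊x⟩`; compare it
with the `p_s` by Cauchy-Schwarz. Upper (`oneLevelAS_upper_bound`): each `p_s` is orthogonal to the
low eigenvectors of the second pencil, so its `A₊`-energy is at most `1/τ♯` times its `A`-energy;
coloring controls the sum. -/

open scoped Matrix

namespace AWG

/-! ### Symmetric pencils and energies of sums. -/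

section BilinearForms

variable {E : Type*} [AddCommGroup E] [Module ℝ E]

/-- Eigenvectors of a symmetric pencil split every vector into a part in the span of the
eigenvectors below a threshold and an orthogonal part on which the Rayleigh quotient is at least
the threshold. -/
theorem exists_low_add_high {ι : Type*} [Fintype ι] (a b : LinearMap.BilinForm ℝ E)
    (ha : ∀ x y, a x y = a y x) (hb : ∀ x y, b x y = b y x) (hb0 : ∀ x, 0 ≤ b x x)
    (lam : ι → ℝ) (y : ι → E) (hspan : Submodule.span ℝ (Set.range y) = ⊤)
    (heig : ∀ k x, a (y k) x = lam k * b (y k) x) (τ : ℝ) (v : E) :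
    ∃ l h, v = l + h ∧ l ∈ Submodule.span ℝ (y '' {k | lam k < τ}) ∧ b l h = 0 ∧ a l h = 0 ∧
      τ * b h h ≤ a h h := by
  classical
  obtain ⟨c, rfl⟩ := (Submodule.mem_span_range_iff_exists_fun ℝ).1
    (hspan ▸ Submodule.mem_top : v ∈ Submodule.span ℝ (Set.range y))
  -- Eigenvectors of one eigenvalue need not be orthogonal; orthogonality between distinct
  -- eigenvalues suffices.
  have key : ∀ i j, lam i ≠ lam j → b (y i) (y j) = 0 := by
    intro i j hij
    have h1 := heig i (y j)
    rw [ha, heig j, hb] at h1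
    have h2 : (lam i - lam j) * b (y i) (y j) = 0 := by rw [sub_mul, h1, sub_self]
    exact (mul_eq_zero.1 h2).resolve_left (sub_ne_zero.2 hij)
  have hlh : ∀ i ∈ Finset.univ.filter (fun k => lam k < τ),
      ∀ j ∈ Finset.univ.filter (fun k => ¬ lam k < τ), b (y i) (y j) = 0 := by
    intro i hi j hj
    simp only [Finset.mem_filter, Finset.mem_univ, true_and, not_lt] at hi hj
    exact key i j (hi.trans_le hj).ne
  refine ⟨∑ k with lam k < τ, c k • y k, ∑ k with ¬ lam k < τ, c k • y k,
    (Finset.sum_filter_add_sum_filter_not _ _ _).symm, ?_, ?_, ?_, ?_⟩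
  · refine Submodule.sum_mem _ fun k hk => Submodule.smul_mem _ _ (Submodule.subset_span ?_)
    exact ⟨k, (Finset.mem_filter.1 hk).2, rfl⟩
  · simp only [map_sum, LinearMap.sum_apply, map_smul, LinearMap.smul_apply, smul_eq_mul,
      Finset.mul_sum]
    refine Finset.sum_eq_zero fun j hj => Finset.sum_eq_zero fun i hi => ?_
    rw [hlh i hi j hj]
    ring
  · simp only [map_sum, LinearMap.sum_apply, map_smul, LinearMap.smul_apply, smul_eq_mul, heig,
      Finset.mul_sum]
    refine Finset.sum_eq_zero fun j hj => Finset.sum_eq_zero fun i hi => ?_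
    rw [hlh i hi j hj]
    ring
  -- The `b`-square of this rescaled vector is exactly `a h h - τ * b h h`: cross terms survive only
  -- when the eigenvalues agree, and then the two square roots multiply to `lam k - τ`.
  · have hz := hb0 (∑ k with ¬ lam k < τ, (c k * √(lam k - τ)) • y k)
    have e : b (∑ k with ¬ lam k < τ, (c k * √(lam k - τ)) • y k)
          (∑ k with ¬ lam k < τ, (c k * √(lam k - τ)) • y k) =
        a (∑ k with ¬ lam k < τ, c k • y k) (∑ k with ¬ lam k < τ, c k • y k) -
          τ * b (∑ k with ¬ lam k < τ, c k • y k) (∑ k with ¬ lam k < τ, c k • y k) := by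
      simp only [map_sum, LinearMap.sum_apply, map_smul, LinearMap.smul_apply, smul_eq_mul, heig,
        Finset.mul_sum]
      rw [← Finset.sum_sub_distrib]
      refine Finset.sum_congr rfl fun j hj => ?_
      rw [← Finset.sum_sub_distrib]
      refine Finset.sum_congr rfl fun i hi => ?_
      simp only [Finset.mem_filter, Finset.mem_univ, true_and, not_lt] at hi hj
      by_cases hij : lam i = lam j
      · rw [hij]
        have hs := Real.mul_self_sqrt (sub_nonneg.2 hj)
        linear_combination (c i * c j * b (y i) (y j)) * hs
      · rw [key i j hij]; ring
    linarith

/-- The Rayleigh quotient is at least the threshold on vectors orthogonal to the eigenvectors below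
it. -/
theorem mul_le_of_forall_low_eq_zero {ι : Type*} [Fintype ι] (a b : LinearMap.BilinForm ℝ E)
    (ha : ∀ x y, a x y = a y x) (hb : ∀ x y, b x y = b y x) (hb0 : ∀ x, x ≠ 0 → 0 < b x x)
    (lam : ι → ℝ) (y : ι → E) (hspan : Submodule.span ℝ (Set.range y) = ⊤)
    (heig : ∀ k x, a (y k) x = lam k * b (y k) x) (τ : ℝ) (p : E)
    (hp : ∀ k, lam k < τ → b (y k) p = 0) : τ * b p p ≤ a p p := by
  have hb1 : ∀ x, 0 ≤ b x x := fun x => by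
    by_cases h : x = 0
    · simp [h]
    · exact (hb0 x h).le
  obtain ⟨l, h, rfl, hl, hbl, -, hle⟩ := exists_low_add_high a b ha hb hb1 lam y hspan heig τ p
  have h0 : Submodule.span ℝ (y '' {k | lam k < τ}) ≤ LinearMap.ker (b (l + h)) := by
    rw [Submodule.span_le]
    rintro _ ⟨k, hk, rfl⟩
    rw [SetLike.mem_coe, LinearMap.mem_ker, hb]
    exact hp k hk
  have h1 : b (l + h) l = 0 := LinearMap.mem_ker.1 (h0 hl)
  rw [map_add, LinearMap.add_apply, hb h l, hbl, add_zero] at h1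
  have h2 : l = 0 := by
    by_contra hne
    exact (hb0 l hne).ne' h1
  simpa [h2] using hle

/-- Summing the squares of `u i - u j` over all pairs gives twice the difference of the two sides.
-/
theorem apply_sum_sum_le_card_mul {κ : Type*} [Fintype κ] (b : LinearMap.BilinForm ℝ E)
    (hb0 : ∀ x, 0 ≤ b x x) (u : κ → E) :
    b (∑ j, u j) (∑ j, u j) ≤ Fintype.card κ * ∑ j, b (u j) (u j) := by
  have h : 0 ≤ ∑ i, ∑ j, b (u i - u j) (u i - u j) :=
    Finset.sum_nonneg fun i _ => Finset.sum_nonneg fun j _ => hb0 _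
  have e1 : b (∑ j, u j) (∑ j, u j) = ∑ i, ∑ j, b (u i) (u j) := by
    simp only [map_sum, LinearMap.sum_apply]
    exact Finset.sum_comm
  have e2 : ∑ i, ∑ j, b (u j) (u i) = ∑ i, ∑ j, b (u i) (u j) := Finset.sum_comm
  simp only [map_sub, LinearMap.sub_apply, Finset.sum_sub_distrib, Finset.sum_const,
    Finset.card_univ, nsmul_eq_mul, ← Finset.mul_sum] at h
  rw [e1]
  linarith

/-- Pythagoras holds within each color class, so only the number of colors is lost, not the number
of summands. -/
theorem apply_sum_sum_le_of_coloring {σ κ : Type*} [Fintype σ] [Fintype κ] [DecidableEq κ]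
    (b : LinearMap.BilinForm ℝ E) (hb0 : ∀ x, 0 ≤ b x x) (w : σ → E) (c : σ → κ)
    (hc : ∀ s t, s ≠ t → c s = c t → b (w s) (w t) = 0) :
    b (∑ s, w s) (∑ s, w s) ≤ Fintype.card κ * ∑ s, b (w s) (w s) := by
  have h := apply_sum_sum_le_card_mul b hb0 fun j => ∑ s with c s = j, w s
  rw [Finset.sum_fiberwise] at h
  have e : ∀ j, b (∑ s with c s = j, w s) (∑ s with c s = j, w s) =
      ∑ s with c s = j, b (w s) (w s) := by
    intro j
    simp only [map_sum, LinearMap.sum_apply]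
    refine Finset.sum_congr rfl fun s hs => Finset.sum_eq_single_of_mem s hs fun t ht hts => ?_
    rw [Finset.mem_filter] at hs ht
    exact hc t s hts (ht.2.trans hs.2.symm)
  simp only [e] at h
  rwa [Finset.sum_fiberwise] at h

end BilinearForms

/-! ### Eigenpairs and positive parts of real matrices. -/

section Matrices

variable {ι κ : Type*} [Fintype ι] [Fintype κ]

theorem transpose_mulVec_dotProduct (M : Matrix κ ι ℝ) (p : κ → ℝ) (w : ι → ℝ) :
    (Mᵀ *ᵥ p) ⬝ᵥ w = p ⬝ᵥ M *ᵥ w := by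
  rw [Matrix.mulVec_transpose, Matrix.dotProduct_mulVec]

theorem _root_.Matrix.IsSymm.dotProduct_mulVec_comm {M : Matrix ι ι ℝ} (hM : M.IsSymm)
    (x y : ι → ℝ) : x ⬝ᵥ M *ᵥ y = y ⬝ᵥ M *ᵥ x := by
  rw [← transpose_mulVec_dotProduct, hM.eq, dotProduct_comm]

theorem _root_.Matrix.PosSemidef.isSymm_real {α : Type*} {M : Matrix α α ℝ} (hM : M.PosSemidef) :
    M.IsSymm := by
  have h := hM.1
  rwa [Matrix.IsHermitian, Matrix.conjTranspose_eq_transpose_of_trivial] at h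

theorem _root_.Matrix.PosSemidef.dotProduct_mulVec_nonneg_real {M : Matrix ι ι ℝ}
    (hM : M.PosSemidef) (x : ι → ℝ) : 0 ≤ x ⬝ᵥ M *ᵥ x := by
  simpa using hM.dotProduct_mulVec_nonneg x

theorem _root_.Matrix.PosDef.dotProduct_mulVec_pos_real {M : Matrix ι ι ℝ}
    (hM : M.PosDef) {x : ι → ℝ} (hx : x ≠ 0) : 0 < x ⬝ᵥ M *ᵥ x := by
  simpa using hM.dotProduct_mulVec_pos hx

theorem IsEigenpairs.span_eq_top {MA MB : Matrix ι ι ℝ} {lam : Fin (Fintype.card ι) → ℝ}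
    {y : Fin (Fintype.card ι) → ι → ℝ} (h : IsEigenpairs MA MB lam y) :
    Submodule.span ℝ (Set.range y) = ⊤ :=
  h.linearIndependent.span_eq_top_of_card_eq_finrank' (by simp)

theorem IsEigenpairs.dotProduct_mulVec {MA MB : Matrix ι ι ℝ} {lam : Fin (Fintype.card ι) → ℝ}
    {y : Fin (Fintype.card ι) → ι → ℝ} (h : IsEigenpairs MA MB lam y) (hA : MA.IsSymm)
    (hB : MB.IsSymm) (k : Fin (Fintype.card ι)) (x : ι → ℝ) :
    y k ⬝ᵥ MA *ᵥ x = lam k * (y k ⬝ᵥ MB *ᵥ x) := by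
  rw [hA.dotProduct_mulVec_comm, h.eigen, dotProduct_smul, smul_eq_mul,
    hB.dotProduct_mulVec_comm]

/-- By monotonicity the cut by index catches every eigenvalue below `τ`. The adjoined `m` makes the
set nonempty, so `sInf` is attained. -/
theorem lt_lowCount {m : ℕ} {τ : ℝ} {lam : Fin m → ℝ} (hlam : Monotone lam) {k : Fin m}
    (hk : lam k < τ) : (k : ℕ) < lowCount τ lam := by
  by_contra! hle
  have hmem : lowCount τ lam ∈ {k : ℕ | ∃ h : k < m, τ ≤ lam ⟨k, h⟩} ∪ {m} :=
    Nat.sInf_mem ⟨m, Or.inr rfl⟩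
  rcases hmem with ⟨h, hτ⟩ | h
  · exact absurd (hτ.trans (hlam (Fin.le_def.2 hle))) (not_le.2 hk)
  · have := k.2
    rw [Set.mem_singleton_iff] at h
    omega

theorem mem_matRange_mul_lowEigenvectors {α : Type*} {m : ℕ} {τ : ℝ} {lam : Fin m → ℝ} (hlam : Monotone lam)
    (y : Fin m → ι → ℝ) (M : Matrix α ι ℝ) {k : Fin m}
    (hk : lam k < τ) : M *ᵥ y k ∈ matRange (M * lowEigenvectors τ lam y) := by
  refine ⟨Pi.single ⟨k, lt_lowCount hlam hk⟩ 1, ?_⟩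
  rw [Matrix.mulVecLin_apply, ← Matrix.mulVec_mulVec, Matrix.mulVec_single_one]
  rfl

/-- In this form the positive part and `B` share the factor `V`, so they are compared entrywise on
the diagonal. -/
theorem positivePart_eq [DecidableEq ι] (V : Matrix ι ι ℝ) (d : ι → ℝ) :
    positivePart V d = V * Matrix.diagonal (fun k => max (d k) 0) * Vᵀ := by
  classical
  ext i j
  rw [positivePart, Matrix.mul_apply, Matrix.mul_apply]
  simp only [Matrix.mul_diagonal, Matrix.submatrix_apply, id, Matrix.transpose_apply]
  rw [← Finset.sum_subtype (Finset.univ.filter fun k => 0 < d k) (by simp)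
    (fun k => V i k * d k * V j k), Finset.sum_filter]
  refine Finset.sum_congr rfl fun k _ => ?_
  split_ifs with h
  · rw [max_eq_left h.le]
  · rw [max_eq_right (not_lt.1 h)]; ring

theorem posSemidef_mul_diagonal_mul_transpose [DecidableEq ι] (V : Matrix ι ι ℝ) {d : ι → ℝ}
    (hd : ∀ k, 0 ≤ d k) : (V * Matrix.diagonal d * Vᵀ).PosSemidef := by
  have h := (Matrix.PosSemidef.diagonal hd).mul_mul_conjTranspose_same V
  rwa [Matrix.conjTranspose_eq_transpose_of_trivial] at h

theorem posSemidef_positivePart [DecidableEq ι] (V : Matrix ι ι ℝ) (d : ι → ℝ) :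
    (positivePart V d).PosSemidef := by
  rw [positivePart_eq]
  exact posSemidef_mul_diagonal_mul_transpose V fun k => le_max_right _ _

theorem IsDiagonalization.posSemidef_positivePart_sub [DecidableEq ι] {B V : Matrix ι ι ℝ}
    {d : ι → ℝ} (h : IsDiagonalization B V d) : (positivePart V d - B).PosSemidef := by
  have e : positivePart V d - B = V * Matrix.diagonal (fun k => max (d k) 0 - d k) * Vᵀ := by
    rw [positivePart_eq, h.eq, ← Matrix.diagonal_sub, Matrix.mul_sub, Matrix.sub_mul]
  rw [e]
  exact posSemidef_mul_diagonal_mul_transpose V fun k => sub_nonneg.2 (le_max_left _ _)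

end Matrices

/-! ### Local problems and the two bounds for the one-level preconditioner. -/

section Restriction

variable {n N : ℕ}

theorem restriction_mul_transpose (S : Finset (Fin n)) :
    restriction S * (restriction S)ᵀ = 1 := by
  have h := restriction_mul_diagonal S fun _ => 1
  rwa [Matrix.diagonal_one, Matrix.mul_one, Matrix.diagonal_one] at h

theorem _root_.Matrix.PosDef.restriction {M : Matrix (Fin n) (Fin n) ℝ} (hM : M.PosDef)
    (S : Finset (Fin n)) : (restriction S * M * (restriction S)ᵀ).PosDef := by
  have h := hM.mul_mul_conjTranspose_same (B := AWG.restriction S) ?_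
  · rwa [Matrix.conjTranspose_eq_transpose_of_trivial] at h
  · intro x y hxy
    have := congrArg (fun z => z ᵥ* (AWG.restriction S)ᵀ) hxy
    simpa [Matrix.vecMul_vecMul, restriction_mul_transpose] using this

theorem assemble_mulVec (Ω : Fin N → Finset (Fin n)) (L : ∀ s, Matrix (Ω s) (Ω s) ℝ)
    (x : Fin n → ℝ) :
    assemble Ω L *ᵥ x = ∑ s, (restriction (Ω s))ᵀ *ᵥ L s *ᵥ restriction (Ω s) *ᵥ x := by
  simp only [assemble, Matrix.sum_mulVec, Matrix.mulVec_mulVec, Matrix.mul_assoc]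

theorem dotProduct_assemble_mulVec (Ω : Fin N → Finset (Fin n)) (L : ∀ s, Matrix (Ω s) (Ω s) ℝ)
    (x y : Fin n → ℝ) :
    x ⬝ᵥ assemble Ω L *ᵥ y =
      ∑ s, (restriction (Ω s) *ᵥ x) ⬝ᵥ L s *ᵥ restriction (Ω s) *ᵥ y := by
  rw [assemble_mulVec, dotProduct_sum]
  refine Finset.sum_congr rfl fun s _ => ?_
  rw [dotProduct_comm, transpose_mulVec_dotProduct, dotProduct_comm]

theorem isSymm_assemble (Ω : Fin N → Finset (Fin n)) {L : ∀ s, Matrix (Ω s) (Ω s) ℝ}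
    (hL : ∀ s, (L s).IsSymm) : (assemble Ω L).IsSymm := by
  simp only [Matrix.IsSymm, assemble, Matrix.transpose_sum, Matrix.transpose_mul,
    Matrix.transpose_transpose, (hL _).eq, Matrix.mul_assoc]

theorem posSemidef_assemble (Ω : Fin N → Finset (Fin n)) {L : ∀ s, Matrix (Ω s) (Ω s) ℝ}
    (hL : ∀ s, (L s).PosSemidef) : (assemble Ω L).PosSemidef := by
  refine Matrix.posSemidef_sum _ fun s _ => ?_
  have h := (hL s).conjTranspose_mul_mul_same (restriction (Ω s))
  rwa [Matrix.conjTranspose_eq_transpose_of_trivial] at h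

theorem transpose_mulVec_mem_lowSpace (Ω : Fin N → Finset (Fin n)) (τ : ℝ)
    {lam : ∀ s, Fin (Fintype.card (Ω s)) → ℝ} (y : ∀ s, Fin (Fintype.card (Ω s)) → Ω s → ℝ)
    (s : Fin N) (hlam : Monotone (lam s)) {k : Fin (Fintype.card (Ω s))} (hk : lam s k < τ) :
    (restriction (Ω s))ᵀ *ᵥ y s k ∈ lowSpace Ω τ lam y :=
  Submodule.mem_iSup_of_mem s (mem_matRange_mul_lowEigenvectors hlam (y s) _ hk)

/-- The local solutions `(R^s A R^sᵀ)⁻¹ R^s w`. -/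
noncomputable def localSolve (Ω : Fin N → Finset (Fin n)) (A : Matrix (Fin n) (Fin n) ℝ)
    (w : Fin n → ℝ) (s : Fin N) : Ω s → ℝ :=
  (restriction (Ω s) * A * (restriction (Ω s))ᵀ)⁻¹ *ᵥ restriction (Ω s) *ᵥ w

theorem oneLevelAS_mulVec (Ω : Fin N → Finset (Fin n)) (A : Matrix (Fin n) (Fin n) ℝ)
    (w : Fin n → ℝ) :
    oneLevelAS Ω A *ᵥ w = ∑ s, (restriction (Ω s))ᵀ *ᵥ localSolve Ω A w s :=
  assemble_mulVec Ω _ w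

theorem mulVec_localSolve (Ω : Fin N → Finset (Fin n)) {A : Matrix (Fin n) (Fin n) ℝ}
    (hA : A.PosDef) (w : Fin n → ℝ) (s : Fin N) :
    (restriction (Ω s) * A * (restriction (Ω s))ᵀ) *ᵥ localSolve Ω A w s =
      restriction (Ω s) *ᵥ w := by
  rw [localSolve, Matrix.mulVec_mulVec, Matrix.mul_nonsing_inv, Matrix.one_mulVec]
  exact (Matrix.isUnit_iff_isUnit_det _).1 (hA.restriction _).isUnit

/-- This energy identity reduces both bounds to comparisons on single subdomains. -/
theorem oneLevelAS_mulVec_dotProduct (Ω : Fin N → Finset (Fin n))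
    {A : Matrix (Fin n) (Fin n) ℝ} (hA : A.PosDef) (w : Fin n → ℝ) :
    (oneLevelAS Ω A *ᵥ w) ⬝ᵥ w = ∑ s, localSolve Ω A w s ⬝ᵥ
      (restriction (Ω s) * A * (restriction (Ω s))ᵀ) *ᵥ localSolve Ω A w s := by
  rw [oneLevelAS_mulVec, sum_dotProduct]
  refine Finset.sum_congr rfl fun s _ => ?_
  rw [transpose_mulVec_dotProduct, mulVec_localSolve Ω hA]

theorem isSymm_oneLevelAS (Ω : Fin N → Finset (Fin n)) {A : Matrix (Fin n) (Fin n) ℝ}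
    (hA : A.PosDef) : (oneLevelAS Ω A).IsSymm :=
  isSymm_assemble Ω fun s => (hA.restriction (Ω s)).inv.posSemidef.isSymm_real

/-- The one-level preconditioner is bounded above on the orthogonal complement of the coarse
space. -/
theorem oneLevelAS_upper_bound {A Ap : Matrix (Fin n) (Fin n) ℝ} (hA : A.PosDef)
    (hAp : Ap.PosDef) (Ω : Fin N → Finset (Fin n)) {τ : ℝ} (hτ : 0 < τ)
    {lam : ∀ s, Fin (Fintype.card (Ω s)) → ℝ} {y : ∀ s, Fin (Fintype.card (Ω s)) → Ω s → ℝ}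
    (h : ∀ s, IsEigenpairs (restriction (Ω s) * A * (restriction (Ω s))ᵀ)
      (restriction (Ω s) * Ap * (restriction (Ω s))ᵀ) (lam s) (y s))
    {k : ℕ} (hk : IsColoringConstant Ω Ap k) {x : Fin n → ℝ}
    (hx : ∀ v ∈ lowSpace Ω τ lam y, v ⬝ᵥ Ap *ᵥ x = 0) :
    (oneLevelAS Ω A *ᵥ Ap *ᵥ x) ⬝ᵥ Ap *ᵥ (oneLevelAS Ω A *ᵥ Ap *ᵥ x) ≤
      k / τ * ((oneLevelAS Ω A *ᵥ Ap *ᵥ x) ⬝ᵥ Ap *ᵥ x) := by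
  obtain ⟨C, -, hCU, hC⟩ := hk
  have hcol : ∀ s, ∃ j, s ∈ C j := fun s => Set.mem_iUnion.1 (hCU ▸ Set.mem_univ s)
  choose c hc using hcol
  have hmove : ∀ s t (p : Ω s → ℝ) (q : Ω t → ℝ),
      ((restriction (Ω s))ᵀ *ᵥ p) ⬝ᵥ Ap *ᵥ ((restriction (Ω t))ᵀ *ᵥ q) =
        p ⬝ᵥ (restriction (Ω s) * Ap * (restriction (Ω t))ᵀ) *ᵥ q := by
    intro s t p q
    rw [transpose_mulVec_dotProduct, Matrix.mulVec_mulVec, Matrix.mulVec_mulVec, Matrix.mul_assoc]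
  have h1 := apply_sum_sum_le_of_coloring (Matrix.toBilin' Ap)
    (fun x => by
      rw [Matrix.toBilin'_apply']; exact hAp.posSemidef.dotProduct_mulVec_nonneg_real x)
    (fun s => (restriction (Ω s))ᵀ *ᵥ localSolve Ω A (Ap *ᵥ x) s) c (fun s t hst hcst => by
      rw [Matrix.toBilin'_apply', hmove,
        (hC (c s) s (hc s) t (hcst ▸ hc t)).resolve_right hst]
      simp)
  simp only [Matrix.toBilin'_apply', ← oneLevelAS_mulVec, Fintype.card_fin, hmove] at h1
  refine h1.trans ?_
  rw [oneLevelAS_mulVec_dotProduct Ω hA, div_mul_eq_mul_div, mul_div_assoc]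
  refine mul_le_mul_of_nonneg_left ?_ (Nat.cast_nonneg k)
  rw [Finset.sum_div]
  refine Finset.sum_le_sum fun s _ => ?_
  rw [le_div_iff₀' hτ]
  have hAs := hA.restriction (Ω s)
  have hBs := hAp.restriction (Ω s)
  have h2 := mul_le_of_forall_low_eq_zero
    (Matrix.toBilin' (restriction (Ω s) * A * (restriction (Ω s))ᵀ))
    (Matrix.toBilin' (restriction (Ω s) * Ap * (restriction (Ω s))ᵀ))
    (fun x y => by
      simpa only [Matrix.toBilin'_apply'] using
        hAs.posSemidef.isSymm_real.dotProduct_mulVec_comm x y)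
    (fun x y => by
      simpa only [Matrix.toBilin'_apply'] using
        hBs.posSemidef.isSymm_real.dotProduct_mulVec_comm x y)
    (fun x hx => by
      simpa only [Matrix.toBilin'_apply'] using hBs.dotProduct_mulVec_pos_real hx)
    (lam s) (y s) (h s).span_eq_top
    (fun k x => by
      simpa only [Matrix.toBilin'_apply'] using
        (h s).dotProduct_mulVec hAs.posSemidef.isSymm_real hBs.posSemidef.isSymm_real k x)
    τ (localSolve Ω A (Ap *ᵥ x) s) ?_
  · simpa only [Matrix.toBilin'_apply'] using h2
  -- For a low eigenvector `y` with eigenvalue `λ`, `λ ⟨y, R^s A₊ R^sᵀ p_s⟩ = ⟨y, A_s p_s⟩ = ⟨R^sᵀ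
  -- y, A₊x⟩ = 0`, and `λ > 0` because `A_s` is positive definite.
  · intro i hi
    rw [Matrix.toBilin'_apply']
    have hy : y s i ≠ 0 := (h s).linearIndependent.ne_zero i
    have h3 := (h s).dotProduct_mulVec hAs.posSemidef.isSymm_real hBs.posSemidef.isSymm_real i
    have h4 := h3 (y s i)
    rw [(h s).normalized, mul_one] at h4
    have hpos : 0 < lam s i := h4 ▸ hAs.dotProduct_mulVec_pos_real hy
    have h5 := h3 (localSolve Ω A (Ap *ᵥ x) s)
    rw [mulVec_localSolve Ω hA, ← transpose_mulVec_dotProduct,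
      hx _ (transpose_mulVec_mem_lowSpace Ω τ y s (h s).ordered hi)] at h5
    exact (mul_eq_zero.1 h5.symm).resolve_left hpos.ne'

/-- The one-level preconditioner is bounded below on the orthogonal complement of the coarse
space. -/
theorem oneLevelAS_lower_bound {A Ap : Matrix (Fin n) (Fin n) ℝ} (hA : A.PosDef)
    (Ω : Fin N → Finset (Fin n)) {D : ∀ s, Matrix (Ω s) (Ω s) ℝ} (hD : IsPartitionOfUnity Ω D)
    {Aps : ∀ s, Matrix (Ω s) (Ω s) ℝ} (hAps : ∀ s, (Aps s).PosSemidef)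
    (hAp : Ap = assemble Ω Aps) {τ : ℝ} (hτ : 0 < τ)
    {lam : ∀ s, Fin (Fintype.card (Ω s)) → ℝ} {y : ∀ s, Fin (Fintype.card (Ω s)) → Ω s → ℝ}
    (h : ∀ s, IsEigenpairs ((D s)⁻¹ * Aps s * (D s)⁻¹)
      (restriction (Ω s) * A * (restriction (Ω s))ᵀ) (lam s) (y s))
    {x : Fin n → ℝ} (hx : ∀ v ∈ lowSpace Ω τ⁻¹ lam y, v ⬝ᵥ Ap *ᵥ x = 0) :
    x ⬝ᵥ Ap *ᵥ x ≤ τ * ((oneLevelAS Ω A *ᵥ Ap *ᵥ x) ⬝ᵥ Ap *ᵥ x) := by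
  have hDi : ∀ s, ((D s)⁻¹)ᵀ = (D s)⁻¹ := fun s => by
    rw [Matrix.transpose_nonsing_inv, (hD.isSymm s).eq]
  have hMA : ∀ s, ((D s)⁻¹ * Aps s * (D s)⁻¹).PosSemidef := fun s => by
    have h := (hAps s).mul_mul_conjTranspose_same (D s)⁻¹
    rwa [Matrix.conjTranspose_eq_transpose_of_trivial, hDi] at h
  -- The witness `z` is the high part of `D^s R^s x`; the discarded low part is mapped by `R^sᵀ`
  -- into the coarse space, which is orthogonal to `A₊x`.
  have hsplit : ∀ s, ∃ z : Ω s → ℝ,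
      z ⬝ᵥ restriction (Ω s) *ᵥ Ap *ᵥ x =
        (D s *ᵥ restriction (Ω s) *ᵥ x) ⬝ᵥ restriction (Ω s) *ᵥ Ap *ᵥ x ∧
      z ⬝ᵥ (restriction (Ω s) * A * (restriction (Ω s))ᵀ) *ᵥ z ≤
        τ * ((restriction (Ω s) *ᵥ x) ⬝ᵥ Aps s *ᵥ restriction (Ω s) *ᵥ x) := by
    intro s
    have hAs := hA.restriction (Ω s)
    obtain ⟨l, z, hlz, hl, -, hal, hle⟩ := exists_low_add_high
      (Matrix.toBilin' ((D s)⁻¹ * Aps s * (D s)⁻¹))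
      (Matrix.toBilin' (restriction (Ω s) * A * (restriction (Ω s))ᵀ))
      (fun x y => by
        simpa only [Matrix.toBilin'_apply'] using
          (hMA s).isSymm_real.dotProduct_mulVec_comm x y)
      (fun x y => by
        simpa only [Matrix.toBilin'_apply'] using
          hAs.posSemidef.isSymm_real.dotProduct_mulVec_comm x y)
      (fun x => by
        simpa only [Matrix.toBilin'_apply'] using hAs.posSemidef.dotProduct_mulVec_nonneg_real x)
      (lam s) (y s) (h s).span_eq_top
      (fun k x => by
        simpa only [Matrix.toBilin'_apply'] using
          (h s).dotProduct_mulVec (hMA s).isSymm_real hAs.posSemidef.isSymm_real k x)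
      τ⁻¹ (D s *ᵥ restriction (Ω s) *ᵥ x)
    simp only [Matrix.toBilin'_apply'] at hal hle
    refine ⟨z, ?_, ?_⟩
    · have h0 : Submodule.span ℝ (y s '' {k | lam s k < τ⁻¹}) ≤
          LinearMap.ker (dotProductBilin ℝ ℝ (restriction (Ω s) *ᵥ Ap *ᵥ x)) := by
        rw [Submodule.span_le]
        rintro _ ⟨k, hk, rfl⟩
        rw [SetLike.mem_coe, LinearMap.mem_ker]
        change (restriction (Ω s) *ᵥ Ap *ᵥ x) ⬝ᵥ y s k = 0
        rw [dotProduct_comm, ← transpose_mulVec_dotProduct]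
        exact hx _ (transpose_mulVec_mem_lowSpace Ω τ⁻¹ y s (h s).ordered hk)
      have h1 : (restriction (Ω s) *ᵥ Ap *ᵥ x) ⬝ᵥ l = 0 := LinearMap.mem_ker.1 (h0 hl)
      rw [hlz, add_dotProduct, dotProduct_comm l, h1, zero_add]
    · have h1 : (D s *ᵥ restriction (Ω s) *ᵥ x) ⬝ᵥ
          ((D s)⁻¹ * Aps s * (D s)⁻¹) *ᵥ (D s *ᵥ restriction (Ω s) *ᵥ x) =
          (restriction (Ω s) *ᵥ x) ⬝ᵥ Aps s *ᵥ restriction (Ω s) *ᵥ x := by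
        nth_rw 1 [← (hD.isSymm s).eq]
        rw [transpose_mulVec_dotProduct, Matrix.mulVec_mulVec, Matrix.mulVec_mulVec,
          Matrix.mul_assoc (D s)⁻¹, Matrix.mul_nonsing_inv_cancel_left _ _ (hD.nonsingular s),
          Matrix.nonsing_inv_mul_cancel_right _ _ (hD.nonsingular s)]
      -- The two parts are also orthogonal for `D^s⁻¹ A₊^s D^s⁻¹`, so dropping `l` does not increase
      -- this energy.
      have h2 := (hMA s).dotProduct_mulVec_nonneg_real l
      rw [← h1, hlz]
      rw [Matrix.mulVec_add, add_dotProduct, dotProduct_add, dotProduct_add,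
        (hMA s).isSymm_real.dotProduct_mulVec_comm z l, hal]
      rw [inv_mul_le_iff₀ hτ] at hle
      refine hle.trans (mul_le_mul_of_nonneg_left ?_ hτ.le)
      linarith
  choose z hz1 hz2 using hsplit
  set p := localSolve Ω A (Ap *ᵥ x) with hp
  have hsum : ∑ s, z s ⬝ᵥ (restriction (Ω s) * A * (restriction (Ω s))ᵀ) *ᵥ p s =
      x ⬝ᵥ Ap *ᵥ x := by
    simp only [hp, mulVec_localSolve Ω hA, hz1]
    have h1 : ∑ s, (restriction (Ω s))ᵀ *ᵥ D s *ᵥ restriction (Ω s) *ᵥ x = x := by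
      rw [← assemble_mulVec, assemble, hD.sum_eq_one, Matrix.one_mulVec]
    rw [Finset.sum_congr rfl fun s _ => (transpose_mulVec_dotProduct (restriction (Ω s)) _ _).symm,
      ← sum_dotProduct, h1]
  have hE := oneLevelAS_mulVec_dotProduct Ω hA (Ap *ᵥ x)
  rw [← hp] at hE
  have hz3 : ∑ s, z s ⬝ᵥ (restriction (Ω s) * A * (restriction (Ω s))ᵀ) *ᵥ z s ≤
      τ * (x ⬝ᵥ Ap *ᵥ x) := by
    conv_rhs => rw [hAp, dotProduct_assemble_mulVec, Finset.mul_sum]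
    exact Finset.sum_le_sum fun s _ => hz2 s
  -- Cauchy-Schwarz as one square: with `X = ⟨x, A₊x⟩` and `E` the energy of the `p_s`, `0 ≤ τ²E -
  -- 2τX + τX`, hence `X ≤ τE`.
  have hnn : 0 ≤ ∑ s, (τ • p s - z s) ⬝ᵥ
      (restriction (Ω s) * A * (restriction (Ω s))ᵀ) *ᵥ (τ • p s - z s) :=
    Finset.sum_nonneg fun s _ =>
      (hA.restriction (Ω s)).posSemidef.dotProduct_mulVec_nonneg_real _
  have hexp : ∀ s, (τ • p s - z s) ⬝ᵥ
      (restriction (Ω s) * A * (restriction (Ω s))ᵀ) *ᵥ (τ • p s - z s) =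
      τ ^ 2 * (p s ⬝ᵥ (restriction (Ω s) * A * (restriction (Ω s))ᵀ) *ᵥ p s) -
        2 * τ * (z s ⬝ᵥ (restriction (Ω s) * A * (restriction (Ω s))ᵀ) *ᵥ p s) +
        z s ⬝ᵥ (restriction (Ω s) * A * (restriction (Ω s))ᵀ) *ᵥ z s := by
    intro s
    simp only [Matrix.mulVec_sub, Matrix.mulVec_smul, sub_dotProduct, dotProduct_sub,
      smul_dotProduct, dotProduct_smul, smul_eq_mul]
    rw [(hA.restriction (Ω s)).posSemidef.isSymm_real.dotProduct_mulVec_comm (p s) (z s)]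
    ring
  simp only [hexp, Finset.sum_add_distrib, Finset.sum_sub_distrib, ← Finset.mul_sum, hsum,
    ← hE] at hnn
  refine le_of_mul_le_mul_left (a := τ) ?_ hτ
  linarith

end Restriction

/-! ### The coarse projector and eigenvectors of the hybrid operator. -/

section Coarse

variable {n n0 : ℕ}

theorem IsInterpolation.posDef {V0 : Submodule ℝ (Fin n → ℝ)} {R0 : Matrix (Fin n0) (Fin n) ℝ}
    (h : IsInterpolation V0 R0) {M : Matrix (Fin n) (Fin n) ℝ} (hM : M.PosDef) :
    (R0 * M * R0ᵀ).PosDef := by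
  have hinj : Function.Injective R0.vecMul := by
    -- Rank-nullity: the rank of `R0ᵀ` is `dim V0 = n0`, the number of its columns.
    have h1 : LinearMap.ker R0ᵀ.mulVecLin = ⊥ := by
      have h2 := LinearMap.finrank_range_add_finrank_ker R0ᵀ.mulVecLin
      have h3 : Module.finrank ℝ (LinearMap.range R0ᵀ.mulVecLin) = n0 :=
        (congrArg (fun W : Submodule ℝ (Fin n → ℝ) => Module.finrank ℝ W) h.range_eq).trans
          h.dim_eq.symm
      rw [h3, Module.finrank_fin_fun] at h2
      exact Submodule.finrank_eq_zero.1 (by omega)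
    intro x y hxy
    refine LinearMap.ker_eq_bot.1 h1 ?_
    simpa [Matrix.mulVec_transpose] using hxy
  have h4 := hM.mul_mul_conjTranspose_same (B := R0) hinj
  rwa [Matrix.conjTranspose_eq_transpose_of_trivial] at h4

theorem isSymm_coarseSolve {M : Matrix (Fin n) (Fin n) ℝ} (hM : M.IsSymm)
    (R0 : Matrix (Fin n0) (Fin n) ℝ) : (coarseSolve M R0).IsSymm := by
  simp only [Matrix.IsSymm, coarseSolve, Matrix.transpose_mul, Matrix.transpose_transpose,
    Matrix.transpose_nonsing_inv, hM.eq, Matrix.mul_assoc]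

theorem isSymm_hybrid {H M : Matrix (Fin n) (Fin n) ℝ} (hH : H.IsSymm) (hM : M.IsSymm)
    (R0 : Matrix (Fin n0) (Fin n) ℝ) : (hybrid H M R0).IsSymm := by
  rw [Matrix.IsSymm, hybrid, Matrix.transpose_add, (isSymm_coarseSolve hM R0).eq,
    Matrix.transpose_mul, Matrix.transpose_mul, Matrix.transpose_transpose, hH.eq,
    Matrix.mul_assoc]

/-- An eigenvector of the hybrid operator has eigenvalue one or is orthogonal to the coarse space,
where the operator reduces to the compression of the one-level operator. -/
theorem hybrid_eigenvector {V0 : Submodule ℝ (Fin n → ℝ)} {R0 : Matrix (Fin n0) (Fin n) ℝ}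
    (hR0 : IsInterpolation V0 R0) {H M : Matrix (Fin n) (Fin n) ℝ} (hM : M.PosDef)
    {x : Fin n → ℝ} {α : ℝ} (hx : (hybrid H M R0 * M) *ᵥ x = α • x) :
    α = 1 ∨ (∀ v ∈ V0, v ⬝ᵥ M *ᵥ x = 0) ∧ (H *ᵥ M *ᵥ x) ⬝ᵥ M *ᵥ x = α * (x ⬝ᵥ M *ᵥ x) := by
  have hMs := hM.posSemidef.isSymm_real
  have hK : (R0 * M * coarseSolve M R0) = R0 := by
    have hu := (Matrix.isUnit_iff_isUnit_det _).1 (hR0.posDef hM).isUnit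
    rw [coarseSolve, ← Matrix.mul_assoc, ← Matrix.mul_assoc, Matrix.mul_nonsing_inv _ hu,
      Matrix.one_mul]
  have hP : R0 * M * coarseProjector M R0 = 0 := by
    rw [coarseProjector, Matrix.mul_sub, Matrix.mul_one, ← Matrix.mul_assoc, hK, sub_self]
  -- Applying `R0 * M` to the eigenvalue equation kills the projected term and turns the coarse term
  -- into `R0 * M` itself.
  have h1 : R0 *ᵥ M *ᵥ x = α • (R0 *ᵥ M *ᵥ x) := by
    have h2 := congrArg (fun w => (R0 * M) *ᵥ w) hx
    simp only [Matrix.mulVec_mulVec, Matrix.mulVec_smul] at h2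
    rw [hybrid, ← Matrix.mul_assoc, Matrix.mul_add, hK, ← Matrix.mul_assoc, ← Matrix.mul_assoc,
      hP, Matrix.zero_mul, Matrix.zero_mul, zero_add] at h2
    rwa [Matrix.mulVec_mulVec]
  by_cases hα : α = 1
  · exact Or.inl hα
  have h3 : R0 *ᵥ M *ᵥ x = 0 := by
    have h4 : (1 - α) • (R0 *ᵥ M *ᵥ x) = 0 := by rw [sub_smul, one_smul, ← h1, sub_self]
    exact (smul_eq_zero.1 h4).resolve_left (sub_ne_zero.2 (Ne.symm hα))
  refine Or.inr ⟨?_, ?_⟩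
  · rw [← hR0.range_eq]
    rintro _ ⟨q, rfl⟩
    rw [Matrix.mulVecLin_apply, transpose_mulVec_dotProduct, h3, dotProduct_zero]
  · have h5 : coarseSolve M R0 *ᵥ M *ᵥ x = 0 := by
      rw [coarseSolve, ← Matrix.mulVec_mulVec, h3, Matrix.mulVec_zero]
    have h6 : (coarseProjector M R0)ᵀ *ᵥ M *ᵥ x = M *ᵥ x := by
      rw [coarseProjector, Matrix.transpose_sub, Matrix.transpose_one, Matrix.transpose_mul,
        (isSymm_coarseSolve hMs R0).eq, hMs.eq, Matrix.sub_mulVec, Matrix.one_mulVec,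
        ← Matrix.mulVec_mulVec, h5, Matrix.mulVec_zero, sub_zero]
    have h7 : coarseProjector M R0 *ᵥ H *ᵥ M *ᵥ x = α • x := by
      rw [← hx, ← Matrix.mulVec_mulVec, hybrid, Matrix.add_mulVec, h5, add_zero,
        ← Matrix.mulVec_mulVec, ← Matrix.mulVec_mulVec, h6]
    -- `Πᵀ` fixes `M x`, so it can be inserted there and moved onto `H M x`, where `Π H M x = α x`.
    rw [hMs.dotProduct_mulVec_comm x x, ← smul_eq_mul, ← smul_dotProduct, ← h7]
    have h8 := transpose_mulVec_dotProduct (coarseProjector M R0) (M *ᵥ x) (H *ᵥ M *ᵥ x)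
    rw [h6] at h8
    rw [dotProduct_comm, h8]
    exact dotProduct_comm _ _

end Coarse

/-! ### Reality of the spectrum. -/

/-- The eigenvalues of the product of a symmetric and a positive definite matrix are real and have
real eigenvectors. -/
theorem exists_real_eigenvector {n : ℕ} {H M : Matrix (Fin n) (Fin n) ℝ} (hH : H.IsSymm)
    (hM : M.PosDef) {μ : ℂ}
    (hμ : Module.End.HasEigenvalue (Matrix.toLin' ((H * M).map Complex.ofReal)) μ) :
    μ.im = 0 ∧ ∃ x : Fin n → ℝ, x ≠ 0 ∧ (H * M) *ᵥ x = μ.re • x := by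
  obtain ⟨v, hv⟩ := hμ.exists_hasEigenvector
  have hMs := hM.posSemidef.isSymm_real
  have h1 : (H * M).map Complex.ofReal *ᵥ v = μ • v := by
    simpa using hv.apply_eq_smul
  have hre : (H * M) *ᵥ (fun i => (v i).re) =
      μ.re • (fun i => (v i).re) - μ.im • (fun i => (v i).im) := by
    funext i
    simpa [Matrix.mulVec, dotProduct] using congrArg Complex.re (congrFun h1 i)
  have him : (H * M) *ᵥ (fun i => (v i).im) =
      μ.re • (fun i => (v i).im) + μ.im • (fun i => (v i).re) := by
    funext i
    simpa [Matrix.mulVec, dotProduct] using congrArg Complex.im (congrFun h1 i)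
  set a : Fin n → ℝ := fun i => (v i).re with ha
  set b : Fin n → ℝ := fun i => (v i).im with hb
  have hne : a ≠ 0 ∨ b ≠ 0 := by
    by_contra! hab
    refine hv.2 (funext fun i => Complex.ext ?_ ?_)
    · exact congrFun hab.1 i
    · exact congrFun hab.2 i
  have hS : (M * (H * M)).IsSymm := by
    rw [Matrix.IsSymm, Matrix.transpose_mul, Matrix.transpose_mul, hH.eq, hMs.eq,
      Matrix.mul_assoc]
  -- Testing the symmetry of `M H M` on the real and imaginary parts of the eigenvector leaves
  -- `μ.im` times the sum of their `M`-energies equal to zero.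
  have h2 := hS.dotProduct_mulVec_comm a b
  rw [← Matrix.mulVec_mulVec b M, ← Matrix.mulVec_mulVec a M, hre, him] at h2
  simp only [Matrix.mulVec_add, Matrix.mulVec_sub, Matrix.mulVec_smul, dotProduct_add,
    dotProduct_sub, dotProduct_smul, smul_eq_mul, hMs.dotProduct_mulVec_comm b a] at h2
  have h3 : μ.im * (a ⬝ᵥ M *ᵥ a + b ⬝ᵥ M *ᵥ b) = 0 := by linarith
  have h4 : 0 < a ⬝ᵥ M *ᵥ a + b ⬝ᵥ M *ᵥ b := by
    have ha0 := hM.posSemidef.dotProduct_mulVec_nonneg_real a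
    have hb0 := hM.posSemidef.dotProduct_mulVec_nonneg_real b
    rcases hne with h | h
    · linarith [hM.dotProduct_mulVec_pos_real h]
    · linarith [hM.dotProduct_mulVec_pos_real h]
  have h5 : μ.im = 0 := (mul_eq_zero.1 h3).resolve_right h4.ne'
  refine ⟨h5, ?_⟩
  rw [h5, zero_smul] at hre him
  rw [sub_zero] at hre
  rw [add_zero] at him
  exact hne.elim (fun h => ⟨a, h, hre⟩) fun h => ⟨b, h, him⟩

end AWG

/-! ### The spectral bounds. -/

theorem mainTheorem5 {n N : ℕ}
    -- the spd matrix and the subdomains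
    (A : Matrix (Fin n) (Fin n) ℝ) (hA : A.PosDef)
    (Ω : Fin N → Finset (Fin n)) (hΩ : ∀ i, ∃ s, i ∈ Ω s)
    -- the partition of unity
    (D : ∀ s, Matrix (Ω s) (Ω s) ℝ) (hD : AWG.IsPartitionOfUnity Ω D)
    -- the splitting of `A` into symmetric matrices, diagonalized to define `A₊^s` and `A₊`
    (B : ∀ s, Matrix (Ω s) (Ω s) ℝ) (hBsymm : ∀ s, (B s).IsSymm) (hB : A = AWG.assemble Ω B)
    (V : ∀ s, Matrix (Ω s) (Ω s) ℝ) (d : ∀ s, Ω s → ℝ)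
    (hV : ∀ s, AWG.IsDiagonalization (B s) (V s) (d s))
    (Aps : ∀ s, Matrix (Ω s) (Ω s) ℝ) (hAps : ∀ s, Aps s = AWG.positivePart (V s) (d s))
    (Ap : Matrix (Fin n) (Fin n) ℝ) (hAp : Ap = AWG.assemble Ω Aps)
    -- the thresholds
    (τflat τsharp : ℝ) (hflat : 1 < τflat) (hsharp0 : 0 < τsharp) (hsharp1 : τsharp < 1)
    -- eigenpairs of the pencils `(D^s⁻¹ A₊^s D^s⁻¹, R^s A R^sᵀ)`
    (lam₁ : ∀ s, Fin (Fintype.card (Ω s)) → ℝ)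
    (y₁ : ∀ s, Fin (Fintype.card (Ω s)) → Ω s → ℝ)
    (h₁ : ∀ s, AWG.IsEigenpairs ((D s)⁻¹ * Aps s * (D s)⁻¹)
      (AWG.restriction (Ω s) * A * (AWG.restriction (Ω s))ᵀ) (lam₁ s) (y₁ s))
    -- eigenpairs of the pencils `(R^s A R^sᵀ, R^s A₊ R^sᵀ)`
    (lam₂ : ∀ s, Fin (Fintype.card (Ω s)) → ℝ)
    (y₂ : ∀ s, Fin (Fintype.card (Ω s)) → Ω s → ℝ)
    (h₂ : ∀ s, AWG.IsEigenpairs (AWG.restriction (Ω s) * A * (AWG.restriction (Ω s))ᵀ)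
      (AWG.restriction (Ω s) * Ap * (AWG.restriction (Ω s))ᵀ) (lam₂ s) (y₂ s))
    -- the coarse space and its interpolation matrix
    (V0 : Submodule ℝ (Fin n → ℝ))
    (hV0 : V0 = AWG.lowSpace Ω τflat⁻¹ lam₁ y₁ ⊔ AWG.lowSpace Ω τsharp lam₂ y₂)
    {n0 : ℕ} (R0 : Matrix (Fin n0) (Fin n) ℝ) (hR0 : AWG.IsInterpolation V0 R0)
    -- the coloring constant
    (k : ℕ) (hk : AWG.IsColoringConstant Ω Ap k) :
    ∀ μ : ℂ,
      Module.End.HasEigenvalue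
        (Matrix.toLin' ((AWG.hybrid (AWG.oneLevelAS Ω A) Ap R0 * Ap).map Complex.ofReal)) μ →
      μ.im = 0 ∧ 1 / τflat ≤ μ.re ∧ μ.re ≤ (k : ℝ) / τsharp := by
  
  have hApsd : ∀ s, (Aps s).PosSemidef := fun s => hAps s ▸ AWG.posSemidef_positivePart _ _
  have hApd : Ap.PosDef := by
    have e : Ap = A + AWG.assemble Ω fun s => Aps s - B s := by
      rw [hAp, hB]
      simp only [AWG.assemble, Matrix.mul_sub, Matrix.sub_mul, Finset.sum_sub_distrib]
      abel
    rw [e]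
    exact hA.add_posSemidef (AWG.posSemidef_assemble Ω fun s =>
      hAps s ▸ (hV s).posSemidef_positivePart_sub)
  intro μ hμ
  obtain ⟨him, x, hx0, hx⟩ := AWG.exists_real_eigenvector
    (AWG.isSymm_hybrid (AWG.isSymm_oneLevelAS Ω hA) hApd.posSemidef.isSymm_real R0) hApd hμ
  -- A nonzero vector gives an index, hence a subdomain, hence a color.
  have hk1 : (1 : ℝ) ≤ k := by
    obtain ⟨i, -⟩ := Function.ne_iff.1 hx0
    obtain ⟨s, -⟩ := hΩ i
    obtain ⟨C, -, hCU, -⟩ := hk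
    obtain ⟨j, -⟩ := Set.mem_iUnion.1 (hCU ▸ Set.mem_univ s)
    exact_mod_cast j.pos
  have hflat0 : 0 < τflat := one_pos.trans hflat
  refine ⟨him, ?_⟩
  rcases AWG.hybrid_eigenvector hR0 hApd hx with h | ⟨hV0x, hE⟩
  · rw [h, div_le_one hflat0, one_le_div hsharp0]
    exact ⟨hflat.le, hsharp1.le.trans hk1⟩
  have hpos := hApd.dotProduct_mulVec_pos_real hx0
  constructor
  · have hlow := AWG.oneLevelAS_lower_bound hA Ω hD hApsd hAp hflat0 h₁
      fun v hv => hV0x v (hV0 ▸ Submodule.mem_sup_left hv)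
    rw [hE, ← mul_assoc] at hlow
    rw [div_le_iff₀' hflat0]
    exact le_of_mul_le_mul_right (by rwa [one_mul]) hpos
  · have hup := AWG.oneLevelAS_upper_bound hA hApd Ω hsharp0 h₂ hk
      fun v hv => hV0x v (hV0 ▸ Submodule.mem_sup_right hv)
    rw [hE] at hup
    have hc : 0 < (k : ℝ) / τsharp := div_pos (one_pos.trans_le hk1) hsharp0
    generalize (k : ℝ) / τsharp = c at hup hc ⊢
    set u := AWG.oneLevelAS Ω A *ᵥ Ap *ᵥ x with hu
    -- With `X = ⟨x, A₊x⟩`, `⟨u, A₊x⟩ = λX` and `⟨u, A₊u⟩ ≤ cλX`, so expanding the square gives `0 ≤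
    -- cλX - 2cλX + c²X`, that is `λ ≤ c`.
    have hnn := hApd.posSemidef.dotProduct_mulVec_nonneg_real (u - c • x)
    simp only [Matrix.mulVec_sub, Matrix.mulVec_smul, sub_dotProduct, dotProduct_sub,
      smul_dotProduct, dotProduct_smul, smul_eq_mul,
      hApd.posSemidef.isSymm_real.dotProduct_mulVec_comm x u, hE] at hnn
    have h3 : μ.re * (c * (x ⬝ᵥ Ap *ᵥ x)) ≤ c * (c * (x ⬝ᵥ Ap *ᵥ x)) := by linarith
    exact le_of_mul_le_mul_right h3 (mul_pos hc hpos)
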